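/- Let $f:[0,\infty)\to[0,\infty)$ be non-decreasing and continuously differentiable. Let $L=\{L_t\}_{t\ge0}$ be a Lévy process in $\mathbb{R}^d$, $d\ge1$, with $L_0=0$ a.s., which is symmetric (the processes $\{L_t\}_{t\ge0}$ and $\{-L_t\}_{t\ge0}$ have the same law) and transient ($\mathbb{P}(\lim_{t\to\infty}|L_t|=\infty)=1$). Let $q$ be its symbol, that is, its characteristic exponent: $\mathbb{E}[e^{i\langle\xi,L_t\rangle}]=e^{-tq(\xi)}$ for all $t\ge0$ and $\xi\in\mathbb{R}^d$ (by symmetry $q$ is real-valued and nonnegative). For $x\in\mathbb{R}^d$ and an open bounded set $O\subseteq\mathbb{R}^d$, let $L_O:=\sup\{t\ge0: x+L_t\in O\}$ (with $\sup\emptyset:=0$) be the last exit time from $O$ of the process started at $x$, and write $\mathbb{E}^x[f(L_O)]$ for the expectation of $f(L_O)$. The process is called $f$-strongly transient if $\mathbb{E}^x[f(L_O)]<\infty$ for all $x\in\mathbb{R}^d$ and all open bounded sets $O\subseteq\mathbb{R}^d$, and $f$-weakly transient otherwise. Then the following are equivalent: 1. $L$ is $f$-weakly transient; 2. $\displaystyle\int_{B(0,r)}\int_0^\infty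 f(t)\,e^{-tq(\xi)}\,dt\,d\xi=\infty$ for some $r>0$; 3. $\displaystyle\int_{B(0,r)}\int_0^\infty f(t)\,e^{-tq(\xi)}\,dt\,d\xi=\infty$ for all $r>0$. Here $B(0,r)$ is the open ball of radius $r$ around the origin. -/

import Mathlib

open MeasureTheory ProbabilityTheory Filter Topology Set
open scoped NNReal ENNReal

noncomputable section

/-- A (`d`-dimensional) Lévy process: starts at `0`, has independent and stationary increments, is
stochastically continuous, and has càdlàg paths (the path properties holding almost surely). -/
structure IsLevyProcess {Ω : Type*} [MeasurableSpace Ω] {d : ℕ}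
    (L : ℝ≥0 → Ω → EuclideanSpace ℝ (Fin d)) (P : Measure Ω) : Prop where
  measurable : ∀ t, Measurable (L t)
  start_zero : ∀ᵐ ω ∂P, L 0 ω = 0
  indep_increments : HasIndepIncrements L P
  stationary_increments : ∀ s t : ℝ≥0, P.map (fun ω => L (s + t) ω - L s ω) = P.map (L t)
  stochastically_continuous : ∀ t : ℝ≥0, TendstoInMeasure P L (𝓝 t) (L t)
  cadlag : ∀ᵐ ω ∂P, ∀ t : ℝ≥0,
    ContinuousWithinAt (fun s => L s ω) (Ici t) t ∧
      ∃ l : EuclideanSpace ℝ (Fin d), Tendsto (fun s => L s ω) (𝓝[<] t) (𝓝 l)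

/-- The process is symmetric: `{L_t}` and `{-L_t}` have the same law on path space (with the
product σ-algebra). -/
def IsSymmetricProcess {Ω : Type*} [MeasurableSpace Ω] {d : ℕ}
    (L : ℝ≥0 → Ω → EuclideanSpace ℝ (Fin d)) (P : Measure Ω) : Prop :=
  IdentDistrib (fun ω t => L t ω) (fun ω t => -L t ω) P P

/-- The process is transient: `P(|L_t| → ∞ as t → ∞) = 1`. -/
def IsTransientProcess {Ω : Type*} [MeasurableSpace Ω] {d : ℕ}
    (L : ℝ≥0 → Ω → EuclideanSpace ℝ (Fin d)) (P : Measure Ω) : Prop :=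
  ∀ᵐ ω ∂P, Tendsto (fun t : ℝ≥0 => ‖L t ω‖) atTop atTop

/-- `q` is the symbol (characteristic exponent) of the Lévy process `L`:
`E[exp(i⟨ξ, L_t⟩)] = exp(-t q(ξ))` for all `t ≥ 0` and all `ξ`. (This determines `q`.) -/
def IsLevySymbol {Ω : Type*} [MeasurableSpace Ω] {d : ℕ}
    (L : ℝ≥0 → Ω → EuclideanSpace ℝ (Fin d)) (P : Measure Ω)
    (q : EuclideanSpace ℝ (Fin d) → ℂ) : Prop :=
  ∀ (t : ℝ≥0) (ξ : EuclideanSpace ℝ (Fin d)),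
    charFun (P.map (L t)) ξ = Complex.exp (-(((t : ℝ) : ℂ) * q ξ))

/-- The last exit time `sup {t ≥ 0 : X_t ∈ O}` of a path `X` from the set `O`, with values in
`[0, ∞]` (it is `0` if the path never visits `O`). -/
def lastExitTime {E : Type*} (X : ℝ≥0 → E) (O : Set E) : ℝ≥0∞ :=
  ⨆ t ∈ {t : ℝ≥0 | X t ∈ O}, (t : ℝ≥0∞)

/-- `f`-strong transience of a transient Lévy process: `E^x[f(L_O)] < ∞` for every starting point
`x` and every open bounded set `O`. The process under `P^x` is `x + L`. For a transient process the
last exit time of a bounded set is almost surely finite, so that `toReal` only changes its type. -/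
def IsStronglyTransient {Ω : Type*} [MeasurableSpace Ω] {d : ℕ} (f : ℝ → ℝ)
    (L : ℝ≥0 → Ω → EuclideanSpace ℝ (Fin d)) (P : Measure Ω) : Prop :=
  ∀ (x : EuclideanSpace ℝ (Fin d)) (O : Set (EuclideanSpace ℝ (Fin d))),
    IsOpen O → Bornology.IsBounded O →
      ∫⁻ ω, ENNReal.ofReal (f (lastExitTime (fun t => x + L t ω) O).toReal) ∂P < ∞

/-- `f`-weak transience of a transient Lévy process: it is not `f`-strongly transient. -/
def IsWeaklyTransient {Ω : Type*} [MeasurableSpace Ω] {d : ℕ} (f : ℝ → ℝ)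
    (L : ℝ≥0 → Ω → EuclideanSpace ℝ (Fin d)) (P : Measure Ω) : Prop :=
  ¬ IsStronglyTransient f L P

/-- The integral `∫_{B(0,r)} ∫_0^∞ f(t) exp(-t q(ξ)) dt dξ` in `[0, ∞]`, for a nonnegative `f`.
The real part is taken because the symbol is a complex function in general; the symbol of a
symmetric Lévy process is real, so there `(q ξ).re` is `q ξ`. -/
def chungFuchsIntegral {d : ℕ} (f : ℝ → ℝ) (q : EuclideanSpace ℝ (Fin d) → ℂ) (r : ℝ) : ℝ≥0∞ :=
  ∫⁻ ξ in Metric.ball (0 : EuclideanSpace ℝ (Fin d)) r,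
    ∫⁻ t in Ioi (0 : ℝ), ENNReal.ofReal (f t * Real.exp (-(t * (q ξ).re)))

end

/-! ### Comparing characteristic functions with the mass of balls -/

section Fourier

open FourierTransform SchwartzMap Convolution

variable {V : Type*} [NormedAddCommGroup V] [InnerProductSpace ℝ V] [FiniteDimensional ℝ V]
  [MeasurableSpace V] [BorelSpace V]

/-! Write `J(t)` for the integral of `exp (-t Re q)` over `B(0,r)`. Tonelli turns the Chung–Fuchs
integral into `∫ f(t) J(t) dt`. By symmetry `exp (-t Re q)` is the characteristic function of `L t`,
and it is nonnegative. Testing it against a compactly supported kernel with nonnegative transform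
gives `J(t) ≤ C P(L t ∈ B(0,R))` for some `R`, and `P(L t ∈ B(x,δ)) ≤ C J(t)` for some `δ`,
uniformly in `x` (`exists_lintegral_charFun_ball_le`, `exists_measure_ball_le_lintegral_charFun`).
So last exit times have to be compared with weighted occupation times of balls.

Strong transience makes every integral finite: after a visit to a ball, the path escapes for good
within `m` steps with a probability `c > 0`, independently of the past. Along `s + ℕ` at most `m`
visits are followed by such an escape, each with weight at most `f` of the last exit time
(`IsLevyProcess.exists_tsum_le`). Integrating over `s` in `(0,1]` bounds the integral.

One finite integral gives strong transience: if the last exit occurs around time `kh`, the path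
visits the set there, and by an Ottaviani inequality it is then likely to be near the set at any
given time shortly afterwards (`IsLevyProcess.measure_exists_mem_le`). Since `f` is monotone,
`f((k+1)h)` times the hitting probability is at most a constant times the mean of `f J` over a
slightly later interval, and these intervals are disjoint.

Hence one finite integral forces all of them to be finite, which yields both equivalences. -/

theorem integral_fourier_eq_integral_mul_charFun (ν : Measure V) [IsProbabilityMeasure ν]
    {f : V → ℂ} (hf : Integrable f) :
    ∫ y, 𝓕 f y ∂ν = ∫ v, f v * charFun ν (-(2 * Real.pi) • v) := by
  have h := VectorFourier.integral_fourierIntegral_smul_eq_flip (μ := (volume : Measure V))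
    (ν := ν) (L := innerₗ V) (f := f) (g := fun _ => (1 : ℂ)) Real.continuous_fourierChar
    continuous_inner hf (integrable_const _)
  simp only [smul_eq_mul, mul_one] at h
  refine Eq.trans ?_ (h.trans ?_)
  · rfl
  · congr with v
    rw [charFun_eq_fourierIntegral', flip_innerₗ]
    congr 2
    rw [smul_smul]
    field_simp
    simp

/-- A nonnegative, compactly supported kernel with nonnegative Fourier transform. -/
theorem exists_positive_kernel {ε : ℝ} (hε : 0 < ε) :
    ∃ (K : 𝓢(V, ℂ)) (k h : V → ℝ) (M c : ℝ), 0 < c ∧ (∀ x, K x = k x) ∧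
      (∀ ξ, 𝓕 K ξ = h ξ) ∧ (∀ x, 0 ≤ k x) ∧ (∀ x, k x ≤ M) ∧ (∀ x, 2 * ε ≤ ‖x‖ → k x = 0) ∧
      (∀ ξ, 0 ≤ h ξ) ∧ (∀ ξ, ‖ξ‖ ≤ 1 / (6 * ε) → c ≤ h ξ) := by
  let b : ContDiffBump (0 : V) := ⟨ε / 2, ε, by positivity, by linarith⟩
  have hcs : HasCompactSupport (fun x => ((b x : ℝ) : ℂ)) :=
    b.hasCompactSupport.comp_left (g := fun r : ℝ => (r : ℂ)) (by simp)
  have hcd : ContDiff ℝ (⊤ : ℕ∞) (fun x => ((b x : ℝ) : ℂ)) :=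
    Complex.ofRealCLM.contDiff.comp b.contDiff
  let G : 𝓢(V, ℂ) := hcs.toSchwartzMap hcd
  have hG : ∀ x, G x = ((b x : ℝ) : ℂ) := fun x => rfl
  -- As `b` is even, its transform is the real function `a`, so the transform of the
  -- self-convolution `K` is `a ^ 2 ≥ 0`. The support of `K` lies in the ball of radius `2 * ε`.
  let K := convolution (ContinuousLinearMap.mul ℂ ℂ) G G
  let k : V → ℝ := fun x => ∫ y, b y * b (x - y)
  let a : V → ℝ := fun ξ => ∫ x, b x * Real.cos (2 * Real.pi * inner ℝ x ξ)
  have hbint : Integrable (fun x => b x) := b.integrable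
  have hcosint : ∀ ξ, Integrable (fun x => b x * Real.cos (2 * Real.pi * inner ℝ x ξ)) := by
    intro ξ
    refine hbint.mul_bdd (c := 1) (by fun_prop) (ae_of_all _ fun x => ?_)
    simpa using Real.abs_cos_le_one _
  have hKk : ∀ x, K x = k x := by
    intro x
    simp only [K, k, convolution_apply, MeasureTheory.convolution_def, hG,
      ContinuousLinearMap.mul_apply']
    rw [← integral_complex_ofReal]
    simp
  have hFG : ∀ ξ, 𝓕 G ξ = a ξ := by
    intro ξ
    rw [fourier_coe, Real.fourier_eq']
    have h1 : (∫ v, Complex.exp (↑(-2 * Real.pi * inner ℝ v ξ) * Complex.I) • G v)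
        = ∫ v, Complex.exp (↑(2 * Real.pi * inner ℝ v ξ) * Complex.I) • G v := by
      rw [← integral_neg_eq_self]
      congr with v
      simp [hG, b.neg]
    have hi : ∀ s : ℝ, Integrable
        (fun v => Complex.exp (↑(s * inner ℝ v ξ) * Complex.I) • G v) := by
      intro s
      refine G.integrable.bdd_mul (c := 1) (by fun_prop) (ae_of_all _ fun x => ?_)
      rw [Complex.norm_exp_ofReal_mul_I]
    have h2 : (∫ v, Complex.exp (↑(-2 * Real.pi * inner ℝ v ξ) * Complex.I) • G v)
        + (∫ v, Complex.exp (↑(2 * Real.pi * inner ℝ v ξ) * Complex.I) • G v)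
        = 2 * (a ξ : ℂ) := by
      rw [← integral_add (hi _) (hi _), ← integral_complex_ofReal, ← integral_const_mul]
      congr with v
      simp only [hG, smul_eq_mul]
      push_cast
      rw [Complex.cos]
      simp only [neg_mul]
      ring
    rw [← h1] at h2
    linear_combination h2 / 2
  refine ⟨K, k, fun ξ => a ξ ^ 2, ∫ x, b x, ((∫ x, b x) / 2) ^ 2, ?_, hKk, ?_, ?_, ?_, ?_, ?_, ?_⟩
  · have := b.integral_pos (μ := volume)
    positivity
  · intro ξ
    simp only [K, fourier_convolution, pairing_apply_apply, hFG, ContinuousLinearMap.mul_apply']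
    push_cast
    ring
  · exact fun x => integral_nonneg fun y => mul_nonneg b.nonneg b.nonneg
  · intro x
    refine integral_mono_of_nonneg (ae_of_all _ fun y => mul_nonneg b.nonneg b.nonneg) hbint
      (ae_of_all _ fun y => ?_)
    exact mul_le_of_le_one_right b.nonneg b.le_one
  · intro x hx
    refine integral_eq_zero_of_ae (ae_of_all _ fun y => ?_)
    rcases le_or_gt ε ‖y‖ with hy | hy
    · simp [b.zero_of_le_dist (x := y) (by simpa using hy)]
    · have : ε ≤ ‖x - y‖ := by
        have := norm_sub_norm_le x y
        linarith
      simp [b.zero_of_le_dist (x := x - y) (by simpa using this)]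
  · exact fun ξ => sq_nonneg _
  · intro ξ hξ
    refine pow_le_pow_left₀ (by have := b.integral_pos (μ := volume); positivity) ?_ 2
    rw [← integral_div]
    refine integral_mono (hbint.div_const 2) (hcosint ξ) fun x => ?_
    rcases le_or_gt ε ‖x‖ with hx | hx
    · simp [b.zero_of_le_dist (x := x) (by simpa using hx)]
    -- The radius `1 / (6 * ε)` keeps the phase below `π / 3` on the support of `b`, where the
    -- cosine is at least `1 / 2`. This gives half of `∫ b` as a lower bound for `a`.
    · have h1 : |2 * Real.pi * inner ℝ x ξ| ≤ Real.pi / 3 := by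
        rw [abs_mul, abs_of_pos (by positivity)]
        have h2 : |inner ℝ x ξ| ≤ 1 / 6 := by
          calc |inner ℝ x ξ| ≤ ‖x‖ * ‖ξ‖ := abs_real_inner_le_norm x ξ
            _ ≤ ε * (1 / (6 * ε)) := by gcongr
            _ = 1 / 6 := by field_simp
        nlinarith [Real.pi_pos]
      have h3 : 1 / 2 ≤ Real.cos (2 * Real.pi * inner ℝ x ξ) := by
        rw [← Real.cos_abs, ← Real.cos_pi_div_three]
        exact Real.cos_le_cos_of_nonneg_of_le_pi (abs_nonneg _) (by linarith [Real.pi_pos]) h1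
      have := b.nonneg (x := x)
      simp only
      nlinarith

end Fourier

/-- Reconciles the conventions `exp(-2πi⟨x, ξ⟩)` of the Fourier transform and `exp(i⟨x, ξ⟩)` of
`charFun`. -/
theorem charFun_map_scale {V : Type*} [NormedAddCommGroup V] [InnerProductSpace ℝ V]
    [MeasurableSpace V] [BorelSpace V] (μ : Measure V) (ξ : V) :
    charFun (μ.map ((-(2 * Real.pi)⁻¹) • ·)) (-(2 * Real.pi) • ξ) = charFun μ ξ := by
  rw [charFun_map_smul, smul_smul]
  congr 1
  have : -(2 * Real.pi)⁻¹ * -(2 * Real.pi) = 1 := by field_simp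
  rw [this, one_smul]

theorem preimage_scale_ball {V : Type*} [NormedAddCommGroup V] [InnerProductSpace ℝ V]
    (x : V) (ρ : ℝ) :
    ((-(2 * Real.pi)⁻¹) • · : V → V) ⁻¹' Metric.ball ((-(2 * Real.pi)⁻¹) • x) ρ
      = Metric.ball x (2 * Real.pi * ρ) := by
  ext y
  have : 0 < 2 * Real.pi := by positivity
  rw [mem_preimage, Metric.mem_ball, Metric.mem_ball, dist_smul₀, norm_neg, norm_inv,
    Real.norm_of_nonneg this.le, inv_mul_lt_iff₀ this]

section Fourier

open FourierTransform SchwartzMap Convolution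

variable {V : Type*} [NormedAddCommGroup V] [InnerProductSpace ℝ V] [FiniteDimensional ℝ V]
  [MeasurableSpace V] [BorelSpace V]

/-- Parseval for the inverse transform of `K` reads `∫ k dν = ∫ h(-v) φ(v) dv`. With `ε = 1 / (6 *
r)` the factor `h` is at least `c` on `B(0,r)`, and nonnegativity of `h` and `φ` allows the rest of
the right side to be dropped. The left side sees only the support of `k`. -/
theorem exists_lintegral_scaled_charFun_ball_le {r : ℝ} (hr : 0 < r) :
    ∃ R : ℝ, 0 < R ∧ ∃ C : ℝ≥0, ∀ (ν : Measure V) [IsProbabilityMeasure ν] (φ : V → ℝ),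
      (∀ ξ, 0 ≤ φ ξ) → (∀ ξ, charFun ν (-(2 * Real.pi) • ξ) = φ ξ) →
      ∫⁻ ξ in Metric.ball 0 r, ENNReal.ofReal (φ ξ) ≤ C * ν (Metric.ball 0 R) := by
  obtain ⟨K, k, h, M, c, hc, hK, hFK, hk0, hkM, hksupp, hh0, hhc⟩ :=
    exists_positive_kernel (V := V) (ε := 1 / (6 * r)) (by positivity)
  have hM : 0 ≤ M := (hk0 0).trans (hkM 0)
  refine ⟨2 * (1 / (6 * r)), by positivity, (c⁻¹ * M).toNNReal, fun ν _ φ hφ0 hφ => ?_⟩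
  have hinv : ∀ v, 𝓕⁻ K v = h (-v) := fun v => by
    rw [fourierInv_apply_eq]
    exact hFK (-v)
  have hmain := integral_fourier_eq_integral_mul_charFun ν (𝓕⁻ K).integrable
  rw [← fourier_coe, FourierTransform.fourier_fourierInv_eq] at hmain
  simp only [hK, hinv, hφ] at hmain
  have hφn : ∀ v, ‖φ v‖ ≤ 1 := fun v => by
    rw [← Complex.norm_real, ← hφ]
    exact norm_charFun_le_one _
  have hφm : Measurable φ := by
    have : φ = fun ξ => (charFun ν (-(2 * Real.pi) • ξ)).re := by
      ext ξ; rw [hφ]; simp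
    rw [this]
    exact Complex.measurable_re.comp (measurable_charFun.comp (by fun_prop))
  have hhi : Integrable (fun v => h (-v)) := by
    have := (𝓕⁻ K).integrable.re (μ := volume)
    simpa [hinv] using this
  have hint : Integrable (fun v => h (-v) * φ v) :=
    hhi.mul_bdd (c := 1) hφm.aestronglyMeasurable (ae_of_all _ hφn)
  have hmain' : ∫ y, k y ∂ν = ∫ v, h (-v) * φ v := by
    have h1 : (∫ y, (k y : ℂ) ∂ν) = ((∫ y, k y ∂ν : ℝ) : ℂ) := integral_complex_ofReal
    have h2 : (∫ v, (h (-v) : ℂ) * (φ v : ℂ)) = ((∫ v, h (-v) * φ v : ℝ) : ℂ) := by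
      rw [← integral_complex_ofReal]; simp
    rw [h1, h2] at hmain
    exact_mod_cast hmain
  have hkint : Integrable k ν := by
    refine Integrable.of_bound (C := M) ?_ (ae_of_all _ fun x => ?_)
    · have : k = fun x => (K x).re := by ext x; simp [hK]
      rw [this]
      exact (Complex.continuous_re.comp K.continuous).aestronglyMeasurable
    · rw [Real.norm_of_nonneg (hk0 x)]; exact hkM x
  have hkle : ∫ y, k y ∂ν ≤ M * ν.real (Metric.ball 0 (2 * (1 / (6 * r)))) := by
    calc ∫ y, k y ∂ν ≤ ∫ y, (Metric.ball 0 (2 * (1 / (6 * r)))).indicator (fun _ => M) y ∂ν := by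
          refine integral_mono hkint ((integrable_const M).indicator measurableSet_ball) fun y => ?_
          by_cases hy : y ∈ Metric.ball 0 (2 * (1 / (6 * r)))
          · rw [indicator_of_mem hy]; exact hkM y
          · rw [indicator_of_notMem hy, hksupp y (by simpa using hy)]
      _ = _ := by rw [integral_indicator_const _ measurableSet_ball, smul_eq_mul, mul_comm]
  calc ∫⁻ ξ in Metric.ball 0 r, ENNReal.ofReal (φ ξ)
      ≤ ∫⁻ ξ in Metric.ball 0 r, ENNReal.ofReal (c⁻¹ * (h (-ξ) * φ ξ)) := by
        refine setLIntegral_mono' measurableSet_ball fun ξ hξ => ENNReal.ofReal_le_ofReal ?_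
        have : c ≤ h (-ξ) := by
          refine hhc _ ?_
          rw [norm_neg]
          have : 1 / (6 * (1 / (6 * r))) = r := by field_simp
          rw [this]
          exact (mem_ball_zero_iff.1 hξ).le
        rw [← mul_assoc]
        refine le_mul_of_one_le_left (hφ0 ξ) ?_
        rw [inv_mul_eq_div]
        exact (one_le_div hc).2 this
    _ ≤ ∫⁻ ξ, ENNReal.ofReal (c⁻¹ * (h (-ξ) * φ ξ)) := setLIntegral_le_lintegral _ _
    _ = ENNReal.ofReal (∫ ξ, c⁻¹ * (h (-ξ) * φ ξ)) :=
        (ofReal_integral_eq_lintegral_ofReal (hint.const_mul _) (ae_of_all _ fun ξ =>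
          mul_nonneg (inv_nonneg.2 hc.le) (mul_nonneg (hh0 _) (hφ0 _)))).symm
    _ ≤ ENNReal.ofReal (c⁻¹ * M * ν.real (Metric.ball 0 (2 * (1 / (6 * r))))) := by
        rw [integral_const_mul, ← hmain', mul_assoc]
        gcongr
    _ = _ := by
        rw [ENNReal.ofReal_mul (by positivity), ofReal_measureReal]
        rfl

/-- The roles of `k` and `h` are exchanged: with `ε = r / 2` the kernel `k` lives on `B(0,r)`, while
`h ≥ c` on the `δ`-ball. Recentring `ν` at `x` only multiplies its characteristic function by a
phase, which disappears in absolute value; hence the uniformity in `x`. -/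
theorem exists_measure_ball_le_lintegral_scaled_charFun {r : ℝ} (hr : 0 < r) :
    ∃ δ : ℝ, 0 < δ ∧ ∃ C : ℝ≥0, ∀ (ν : Measure V) [IsProbabilityMeasure ν] (φ : V → ℝ),
      (∀ ξ, 0 ≤ φ ξ) → (∀ ξ, charFun ν (-(2 * Real.pi) • ξ) = φ ξ) →
      ∀ x, ν (Metric.ball x δ) ≤ C * ∫⁻ ξ in Metric.ball 0 r, ENNReal.ofReal (φ ξ) := by
  obtain ⟨K, k, h, M, c, hc, hK, hFK, hk0, hkM, hksupp, hh0, hhc⟩ :=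
    exists_positive_kernel (V := V) (ε := r / 2) (by positivity)
  have hM : 0 ≤ M := (hk0 0).trans (hkM 0)
  refine ⟨1 / (6 * (r / 2)), by positivity, (c⁻¹ * M).toNNReal, fun ν _ φ hφ0 hφ x => ?_⟩
  set δ := 1 / (6 * (r / 2))
  have hprob : IsProbabilityMeasure (ν.map (· + (-x))) :=
    Measure.isProbabilityMeasure_map (by fun_prop)
  have hmain := integral_fourier_eq_integral_mul_charFun (ν.map (· + (-x))) K.integrable
  rw [← fourier_coe, integral_map (by fun_prop) (𝓕 K).continuous.aestronglyMeasurable] at hmain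
  simp only [hK, hFK, charFun_map_add_const, hφ] at hmain
  have hφn : ∀ v, ‖φ v‖ ≤ 1 := fun v => by
    rw [← Complex.norm_real, ← hφ]
    exact norm_charFun_le_one _
  have hφm : Measurable φ := by
    have : φ = fun ξ => (charFun ν (-(2 * Real.pi) • ξ)).re := by
      ext ξ; rw [hφ]; simp
    rw [this]
    exact Complex.measurable_re.comp (measurable_charFun.comp (by fun_prop))
  have hki : Integrable k := by
    have := K.integrable.re (μ := volume)
    simpa [hK] using this
  have hint : Integrable (fun v => k v * φ v) :=
    hki.mul_bdd (c := 1) hφm.aestronglyMeasurable (ae_of_all _ hφn)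
  have hle : ∫ y, h (y + -x) ∂ν ≤ ∫ v, k v * φ v := by
    calc ∫ y, h (y + -x) ∂ν ≤ ‖((∫ y, h (y + -x) ∂ν : ℝ) : ℂ)‖ := by
          rw [Complex.norm_real]; exact le_abs_self _
      _ = ‖∫ y, ((h (y + -x) : ℝ) : ℂ) ∂ν‖ := by rw [integral_complex_ofReal]
      _ ≤ _ := by
          rw [hmain]
          refine (norm_integral_le_integral_norm _).trans_eq (integral_congr_ae (ae_of_all _ ?_))
          intro v
          simp only [norm_mul, Complex.norm_real, Complex.norm_exp_ofReal_mul_I, mul_one,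
            Real.norm_of_nonneg (hk0 v), Real.norm_of_nonneg (hφ0 v)]
  have hhm : AEStronglyMeasurable (fun y => h (y + -x)) ν := by
    have : (fun y => h (y + -x)) = fun y => (𝓕 K (y + -x)).re := by ext y; simp [hFK]
    rw [this]
    exact (Complex.continuous_re.comp ((𝓕 K).continuous.comp (by fun_prop))).aestronglyMeasurable
  have hhi : Integrable (fun y => h (y + -x)) ν := by
    refine Integrable.of_bound hhm (‖K.toLp 1‖) (ae_of_all _ fun y => ?_)
    rw [← Complex.norm_real, ← hFK]
    exact norm_fourier_apply_le_toLp_one K _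
  have hfin : ENNReal.ofReal c * ν (Metric.ball x δ)
      ≤ ENNReal.ofReal M * ∫⁻ ξ in Metric.ball 0 r, ENNReal.ofReal (φ ξ) := by
    calc ENNReal.ofReal c * ν (Metric.ball x δ)
        = ∫⁻ _ in Metric.ball x δ, ENNReal.ofReal c ∂ν := by rw [setLIntegral_const]
      _ ≤ ∫⁻ y in Metric.ball x δ, ENNReal.ofReal (h (y + -x)) ∂ν := by
          refine setLIntegral_mono' measurableSet_ball fun y hy => ENNReal.ofReal_le_ofReal ?_
          refine hhc _ ?_
          rw [← sub_eq_add_neg, ← dist_eq_norm]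
          exact (Metric.mem_ball.1 hy).le
      _ ≤ ∫⁻ y, ENNReal.ofReal (h (y + -x)) ∂ν := setLIntegral_le_lintegral _ _
      _ = ENNReal.ofReal (∫ y, h (y + -x) ∂ν) :=
          (ofReal_integral_eq_lintegral_ofReal hhi (ae_of_all _ fun _ => hh0 _)).symm
      _ ≤ ENNReal.ofReal (∫ v, k v * φ v) := ENNReal.ofReal_le_ofReal hle
      _ = ∫⁻ v, ENNReal.ofReal (k v * φ v) := ofReal_integral_eq_lintegral_ofReal hint
          (ae_of_all _ fun v => mul_nonneg (hk0 v) (hφ0 v))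
      _ ≤ ∫⁻ v, (Metric.ball 0 r).indicator
            (fun v => ENNReal.ofReal M * ENNReal.ofReal (φ v)) v := by
          refine lintegral_mono fun v => ?_
          by_cases hv : v ∈ Metric.ball 0 r
          · rw [indicator_of_mem hv, ← ENNReal.ofReal_mul hM]
            exact ENNReal.ofReal_le_ofReal (mul_le_mul_of_nonneg_right (hkM v) (hφ0 v))
          · rw [hksupp v (by simpa [mul_div_cancel₀] using hv)]
            simp
      _ = _ := by
          rw [lintegral_indicator measurableSet_ball,
            lintegral_const_mul _ (by fun_prop)]
  have hcc : ENNReal.ofReal c ≠ 0 := by simpa using hc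
  calc ν (Metric.ball x δ) = (ENNReal.ofReal c)⁻¹ * (ENNReal.ofReal c * ν (Metric.ball x δ)) := by
        rw [← mul_assoc, ENNReal.inv_mul_cancel hcc ENNReal.ofReal_ne_top, one_mul]
    _ ≤ (ENNReal.ofReal c)⁻¹ *
        (ENNReal.ofReal M * ∫⁻ ξ in Metric.ball 0 r, ENNReal.ofReal (φ ξ)) := by gcongr
    _ = _ := by
        rw [← mul_assoc, ← ENNReal.ofReal_inv_of_pos hc, ← ENNReal.ofReal_mul (by positivity)]
        rfl

/-- The integral over a ball of a nonnegative characteristic function is controlled by the mass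
of a ball around the origin. -/
theorem exists_lintegral_charFun_ball_le {r : ℝ} (hr : 0 < r) :
    ∃ R : ℝ, 0 < R ∧ ∃ C : ℝ≥0, ∀ (μ : Measure V) [IsProbabilityMeasure μ] (φ : V → ℝ),
      (∀ ξ, 0 ≤ φ ξ) → (∀ ξ, charFun μ ξ = φ ξ) →
      ∫⁻ ξ in Metric.ball 0 r, ENNReal.ofReal (φ ξ) ≤ C * μ (Metric.ball 0 R) := by
  obtain ⟨R, hR, C, h⟩ := exists_lintegral_scaled_charFun_ball_le (V := V) hr
  refine ⟨2 * Real.pi * R, by positivity, C, fun μ _ φ hφ0 hφ => ?_⟩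
  have hprob : IsProbabilityMeasure (μ.map ((-(2 * Real.pi)⁻¹) • · : V → V)) :=
    Measure.isProbabilityMeasure_map (by fun_prop)
  refine (h (μ.map ((-(2 * Real.pi)⁻¹) • ·)) φ hφ0
    fun ξ => by rw [charFun_map_scale, hφ]).trans_eq ?_
  rw [Measure.map_apply (by fun_prop) measurableSet_ball]
  have := preimage_scale_ball (0 : V) R
  rw [smul_zero] at this
  rw [this]

/-- The mass of any small ball is controlled by the integral of the nonnegative characteristic
function over a ball around the origin. -/
theorem exists_measure_ball_le_lintegral_charFun {r : ℝ} (hr : 0 < r) :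
    ∃ δ : ℝ, 0 < δ ∧ ∃ C : ℝ≥0, ∀ (μ : Measure V) [IsProbabilityMeasure μ] (φ : V → ℝ),
      (∀ ξ, 0 ≤ φ ξ) → (∀ ξ, charFun μ ξ = φ ξ) →
      ∀ x, μ (Metric.ball x δ) ≤ C * ∫⁻ ξ in Metric.ball 0 r, ENNReal.ofReal (φ ξ) := by
  obtain ⟨δ, hδ, C, h⟩ := exists_measure_ball_le_lintegral_scaled_charFun (V := V) hr
  refine ⟨2 * Real.pi * δ, by positivity, C, fun μ _ φ hφ0 hφ x => ?_⟩
  have hprob : IsProbabilityMeasure (μ.map ((-(2 * Real.pi)⁻¹) • · : V → V)) :=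
    Measure.isProbabilityMeasure_map (by fun_prop)
  refine le_trans (le_of_eq ?_) (h (μ.map ((-(2 * Real.pi)⁻¹) • ·)) φ hφ0
    (fun ξ => by rw [charFun_map_scale, hφ]) ((-(2 * Real.pi)⁻¹) • x))
  rw [Measure.map_apply (by fun_prop) measurableSet_ball, preimage_scale_ball]

end Fourier

/-! ### Independence and stationarity along discrete times -/

section Increments

variable {Ω : Type*} [MeasurableSpace Ω] {P : Measure Ω} {d : ℕ}
  {L : ℝ≥0 → Ω → EuclideanSpace ℝ (Fin d)}

/-- Along a monotone sequence of times, the values up to the `N`-th time are independent of the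
increments after the `N`-th time. -/
theorem IsLevyProcess.indepFun_past_future (hL : IsLevyProcess L P) {τ : ℕ → ℝ≥0}
    (hτ : Monotone τ) (N : ℕ) :
    IndepFun (fun ω (i : ℕ) => L (τ (min i N)) ω) (fun ω (i : ℕ) => L (τ (N + i)) ω - L (τ N) ω)
      P := by
  -- Prepending time `0` makes past values partial sums of increments as well, up to `L 0`, which
  -- vanishes almost surely. The past uses the increments `X 0, …, X N`, the future those with
  -- larger index.
  let σ : ℕ → ℝ≥0 := fun n => Nat.casesOn n 0 τ
  have hσ : Monotone σ := by
    refine monotone_nat_of_le_succ fun n => ?_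
    cases n with
    | zero => exact zero_le
    | succ n => exact hτ (Nat.le_succ n)
  let X : ℕ → Ω → EuclideanSpace ℝ (Fin d) := fun i ω => L (σ (i + 1)) ω - L (σ i) ω
  have hX : iIndepFun X P := hL.indep_increments.nat hσ
  have hXm : ∀ i, Measurable (X i) := fun i => (hL.measurable _).sub (hL.measurable _)
  have hI := indep_iSup_of_disjoint (fun i => (hXm i).comap_le) hX
    (S := {i | i ≤ N}) (T := {i | N < i})
    (by rw [Set.disjoint_left]; intro i hi hi'; simp at hi hi'; omega)
  have hXS : ∀ (S : Set ℕ), ∀ i ∈ S,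
      Measurable[⨆ i ∈ S, MeasurableSpace.comap (X i) inferInstance] (X i) := by
    intro S i hi
    exact (comap_measurable (X i)).mono
      (le_iSup₂ (f := fun i (_ : i ∈ S) => MeasurableSpace.comap (X i) inferInstance) i hi) le_rfl
  have hpast : IndepFun (fun ω (i : ℕ) => L (τ (min i N)) ω - L 0 ω)
      (fun ω (i : ℕ) => L (τ (N + i)) ω - L (τ N) ω) P := by
    refine indep_of_indep_of_le_left (indep_of_indep_of_le_right hI ?_) ?_
    · rw [← measurable_iff_comap_le]
      refine @measurable_pi_lambda Ω ℕ _ (_) _ _ fun i => ?_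
      have : (fun ω => L (τ (N + i)) ω - L (τ N) ω)
          = fun ω => ∑ k ∈ Finset.range i, X (N + 1 + k) ω := by
        ext1 ω
        have := Finset.sum_range_sub (fun k => L (σ (N + 1 + k)) ω) i
        simp only [X]
        simp only [← add_assoc] at this
        rw [this, add_zero]
        have e : N + 1 + i = (N + i) + 1 := by ring
        rw [e]
      rw [this]
      exact @Finset.measurable_fun_sum _ _ _ _ _ _ (_) _ _ fun k _ => hXS _ _ (by simp; omega)
    · rw [← measurable_iff_comap_le]
      refine @measurable_pi_lambda Ω ℕ _ (_) _ _ fun i => ?_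
      have : (fun ω => L (τ (min i N)) ω - L 0 ω)
          = fun ω => ∑ k ∈ Finset.range (min i N + 1), X k ω := by
        ext1 ω
        exact (Finset.sum_range_sub (fun k => L (σ k) ω) (min i N + 1)).symm
      rw [this]
      exact @Finset.measurable_fun_sum _ _ _ _ _ _ (_) _ _ fun k hk => hXS _ _ (by simp at hk; simp; omega)
  refine hpast.congr ?_ .rfl
  filter_upwards [hL.start_zero] with ω hω
  simp [hω]

/-- The law of the increments along the integers does not depend on the starting time. -/
theorem IsLevyProcess.map_increments_eq (hL : IsLevyProcess L P) (s : ℝ≥0) :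
    P.map (fun ω (i : ℕ) => L (s + i) ω - L s ω) = P.map (fun ω (i : ℕ) => L i ω - L 0 ω) := by
  -- The unit increments after `s` are i.i.d. with the law of `L 1`, so the sequence is the
  -- partial-sum image of a product measure in which `s` does not occur.
  have key : ∀ s : ℝ≥0, P.map (fun ω (i : ℕ) => L (s + i) ω - L s ω)
      = (Measure.infinitePi fun _ : ℕ => P.map (L 1)).map
        (fun x (i : ℕ) => ∑ k ∈ Finset.range i, x k) := by
    intro s
    let X : ℕ → Ω → EuclideanSpace ℝ (Fin d) := fun i ω => L (s + ↑(i + 1)) ω - L (s + ↑i) ω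
    have hXm : ∀ i, Measurable (X i) := fun i => (hL.measurable _).sub (hL.measurable _)
    have hX : iIndepFun X P := hL.indep_increments.nat (t := fun i : ℕ => s + (i : ℝ≥0))
      (fun a b h => add_le_add_right (Nat.cast_le.2 h) s)
    have hlaw : ∀ i, P.map (X i) = P.map (L 1) := by
      intro i
      rw [← hL.stationary_increments (s + i) 1]
      simp only [X, Nat.cast_add, Nat.cast_one, add_assoc]
    have h1 := hX.map_fun_eq_infinitePi_map₀ (measurable_pi_lambda _ hXm).aemeasurable
    rw [funext hlaw] at h1
    rw [← h1, Measure.map_map (by fun_prop) (measurable_pi_lambda _ hXm)]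
    congr 1
    ext1 ω
    funext i
    have := Finset.sum_range_sub (fun k : ℕ => L (s + k) ω) i
    simp only [Nat.cast_zero, add_zero] at this
    exact this.symm
  rw [key s, ← key 0]
  simp

end Increments

/-! ### The symbol of a symmetric process -/

section Symbol

variable {Ω : Type*} [MeasurableSpace Ω] {P : Measure Ω} {d : ℕ}
  {L : ℝ≥0 → Ω → EuclideanSpace ℝ (Fin d)} {q : EuclideanSpace ℝ (Fin d) → ℂ}

theorem IsLevySymbol.measurable_re [IsProbabilityMeasure P] (hq : IsLevySymbol L P q) :
    Measurable fun ξ => (q ξ).re := by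
  have h : (fun ξ => (q ξ).re) = fun ξ => -Real.log ‖charFun (P.map (L 1)) ξ‖ := by
    ext ξ
    rw [hq 1 ξ, Complex.norm_exp, Real.log_exp]
    simp
  rw [h]
  exact (Real.measurable_log.comp measurable_charFun.norm).neg

/-- Symmetry makes the characteristic function real at every time. Its value at `t` is the square of
its value at `t / 2`, hence nonnegative and equal to its modulus. -/
theorem IsLevySymbol.charFun_eq (hL : IsLevyProcess L P) (hsymm : IsSymmetricProcess L P)
    (hq : IsLevySymbol L P q) (t : ℝ≥0) (ξ : EuclideanSpace ℝ (Fin d)) :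
    charFun (P.map (L t)) ξ = (Real.exp (-(t * (q ξ).re)) : ℝ) := by
  have hconj : ∀ t, (starRingEnd ℂ) (charFun (P.map (L t)) ξ) = charFun (P.map (L t)) ξ := by
    intro t
    have h := (hsymm.comp (measurable_pi_apply t)).map_eq
    have h2 : P.map ((fun x : ℝ≥0 → EuclideanSpace ℝ (Fin d) => x t) ∘ fun ω t => -L t ω)
        = (P.map (L t)).map ((-1 : ℝ) • ·) := by
      rw [Measure.map_map (by fun_prop) (hL.measurable t)]
      congr 1
      ext1 ω
      simp
    rw [h2] at h
    have h3 : charFun (P.map (L t)) ξ = charFun ((P.map (L t)).map ((-1 : ℝ) • ·)) ξ :=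
      congrArg (fun μ => charFun μ ξ) h
    rw [charFun_map_smul, neg_one_smul, charFun_neg] at h3
    exact h3.symm
  obtain ⟨x, hx⟩ := Complex.conj_eq_iff_real.1 (hconj (t / 2))
  have h1 : charFun (P.map (L t)) ξ = charFun (P.map (L (t / 2))) ξ ^ 2 := by
    rw [hq, hq, ← Complex.exp_nat_mul]
    congr 1
    push_cast
    ring
  have h2 : |x| = Real.exp (-(t / 2 * (q ξ).re)) := by
    have := congrArg norm hx
    rw [hq, Complex.norm_exp, Complex.norm_real, Real.norm_eq_abs] at this
    rw [← this]
    congr 1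
    simp [Complex.mul_re]
  rw [h1, hx, ← Complex.ofReal_pow, ← sq_abs, h2, ← Real.exp_nat_mul]
  congr 2
  push_cast
  ring

end Symbol

/-! ### Occupation sums bounded by the last exit time -/

section OccupationBound

variable {Ω : Type*} [MeasurableSpace Ω] {P : Measure Ω} [IsProbabilityMeasure P] {d : ℕ}
  {L : ℝ≥0 → Ω → EuclideanSpace ℝ (Fin d)}

/-- By transience almost every path is, from some integer `m` on, at distance at least `R` from its
start. There are countably many `m`, so one of these events has positive probability; stationarity
makes that probability independent of `s`. -/
theorem IsLevyProcess.exists_escape_prob (hL : IsLevyProcess L P) (htrans : IsTransientProcess L P)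
    (R : ℝ) : ∃ (m : ℕ) (c : ℝ≥0∞), c ≠ 0 ∧ ∀ s : ℝ≥0,
      P {ω | ∀ k : ℕ, m ≤ k → R ≤ ‖L (s + k) ω - L s ω‖} = c := by
  by_contra! hcon
  let S : ℕ → Set (ℕ → EuclideanSpace ℝ (Fin d)) := fun m => {x | ∀ k : ℕ, m ≤ k → R ≤ ‖x k‖}
  have hS : ∀ m, MeasurableSet (S m) := by
    intro m
    simp only [S, ofPred_forall]
    refine MeasurableSet.iInter fun k => MeasurableSet.iInter fun _ => ?_
    exact measurableSet_le measurable_const (by fun_prop)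
  have hmeas : ∀ s : ℝ≥0, Measurable fun ω (i : ℕ) => L (s + i) ω - L s ω := fun s =>
    measurable_pi_lambda _ fun i => (hL.measurable _).sub (hL.measurable _)
  have hmeas0 : Measurable fun ω (i : ℕ) => L i ω - L 0 ω :=
    measurable_pi_lambda _ fun i => (hL.measurable _).sub (hL.measurable _)
  have heq : ∀ m (s : ℝ≥0), P {ω | ∀ k : ℕ, m ≤ k → R ≤ ‖L (s + k) ω - L s ω‖}
      = P ((fun ω (i : ℕ) => L i ω - L 0 ω) ⁻¹' S m) := by
    intro m s
    rw [← Measure.map_apply hmeas0 (hS m), ← hL.map_increments_eq s,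
      Measure.map_apply (hmeas s) (hS m)]
    rfl
  have hzero : ∀ m, P ((fun ω (i : ℕ) => L i ω - L 0 ω) ⁻¹' S m) = 0 := by
    intro m
    by_contra h
    obtain ⟨s, hs⟩ := hcon m _ h
    exact hs (heq m s)
  have hnull : ∀ᵐ ω ∂P, ∀ m, ω ∉ (fun ω (i : ℕ) => L i ω - L 0 ω) ⁻¹' S m := by
    rw [ae_all_iff]
    exact fun m => measure_eq_zero_iff_ae_notMem.1 (hzero m)
  have : ∀ᵐ ω ∂P, False := by
    filter_upwards [hnull, htrans, hL.start_zero] with ω h1 h2 h3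
    obtain ⟨m, hm⟩ := eventually_atTop.1
      ((h2.comp (tendsto_natCast_atTop_atTop (R := ℝ≥0))).eventually_ge_atTop R)
    exact h1 m fun k hk => by simpa [h3] using hm k hk
  exact IsProbabilityMeasure.ne_zero P (by simpa using this)

theorem lastExitTime_ne_top {E : Type*} [NormedAddCommGroup E] {X : ℝ≥0 → E} {O : Set E}
    (hO : Bornology.IsBounded O) (hX : Tendsto (fun t => ‖X t‖) atTop atTop) :
    lastExitTime X O ≠ ∞ := by
  obtain ⟨R, hR⟩ := hO.exists_norm_le
  obtain ⟨T, hT⟩ := eventually_atTop.1 (hX.eventually_gt_atTop R)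
  refine ne_top_of_le_ne_top (ENNReal.coe_ne_top (r := T)) (iSup₂_le fun t ht => ?_)
  by_contra! h
  exact absurd (hR _ ht) (not_le.2 (hT t (by exact_mod_cast h.le)))

theorem le_toReal_lastExitTime {E : Type*} {X : ℝ≥0 → E} {O : Set E}
    (hX : lastExitTime X O ≠ ∞) {t : ℝ≥0} (ht : X t ∈ O) : (t : ℝ) ≤ (lastExitTime X O).toReal := by
  have : (t : ℝ≥0∞) ≤ lastExitTime X O := le_iSup₂ (f := fun (t : ℝ≥0)
    (_ : t ∈ {t : ℝ≥0 | X t ∈ O}) => (t : ℝ≥0∞)) t ht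
  exact (ENNReal.ofReal_le_iff_le_toReal hX).1 (by simpa using this)

/-- The `f`-weighted occupation measure of a ball along `s + ℕ` is controlled by the
`f`-moment of the last exit time. -/
theorem IsLevyProcess.exists_tsum_le (hL : IsLevyProcess L P) (htrans : IsTransientProcess L P)
    {f : ℝ → ℝ} (hf_mono : MonotoneOn f (Ici 0)) (R : ℝ) :
    ∃ (m : ℕ) (c : ℝ≥0∞), c ≠ 0 ∧ ∀ s : ℝ≥0,
      c * ∑' j : ℕ, ENNReal.ofReal (f (s + j)) * P.map (L (s + j)) (Metric.ball 0 R) ≤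
        m * ∫⁻ ω, ENNReal.ofReal (f (lastExitTime (fun t => 0 + L t ω) (Metric.ball 0 R)).toReal)
          ∂P := by
  obtain ⟨m, c, hc, h⟩ := hL.exists_escape_prob htrans (2 * R)
  refine ⟨m, c, hc, fun s => ?_⟩
  let B : ℕ → Set Ω := fun j => L (s + j) ⁻¹' Metric.ball 0 R
  let G : ℕ → Set Ω := fun j =>
    {ω | ∀ k : ℕ, m ≤ k → 2 * R ≤ ‖L (s + j + k) ω - L (s + j) ω‖}
  have hB : ∀ j, MeasurableSet (B j) := fun j => hL.measurable _ measurableSet_ball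
  have hG : ∀ j, MeasurableSet (G j) := by
    intro j
    simp only [G, ofPred_forall]
    refine MeasurableSet.iInter fun k => MeasurableSet.iInter fun _ => ?_
    exact measurableSet_le measurable_const ((hL.measurable _).sub (hL.measurable _)).norm
  -- The visit `B j` depends on the past and the escape `G j` on later increments, so the
  -- probabilities multiply.
  have hBG : ∀ j : ℕ, c * P.map (L (s + j)) (Metric.ball 0 R) = P (B j ∩ G j) := by
    intro j
    have hind := hL.indepFun_past_future (τ := fun i : ℕ => s + j + (i : ℝ≥0))
      (fun a b h => add_le_add_right (Nat.cast_le.2 h) _) 0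
    have hS : MeasurableSet {x : ℕ → EuclideanSpace ℝ (Fin d) |
        ∀ k : ℕ, m ≤ k → 2 * R ≤ ‖x k‖} := by
      simp only [ofPred_forall]
      refine MeasurableSet.iInter fun k => MeasurableSet.iInter fun _ => ?_
      exact measurableSet_le measurable_const (by fun_prop)
    have h0 : MeasurableSet {x : ℕ → EuclideanSpace ℝ (Fin d) | x 0 ∈ Metric.ball 0 R} :=
      measurable_pi_apply 0 measurableSet_ball
    have := hind.measure_inter_preimage_eq_mul _ _ h0 hS
    rw [Measure.map_apply (hL.measurable _) measurableSet_ball, ← h (s + j), mul_comm]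
    simpa [preimage_ofPred_eq, B, G, preimage, Metric.mem_ball] using this.symm
  calc c * ∑' j : ℕ, ENNReal.ofReal (f (s + j)) * P.map (L (s + j)) (Metric.ball 0 R)
      = ∑' j : ℕ, ENNReal.ofReal (f (s + j)) * P (B j ∩ G j) := by
        rw [← ENNReal.tsum_mul_left]
        refine tsum_congr fun j => ?_
        rw [← hBG]
        ring
    _ = ∫⁻ ω, ∑' j : ℕ, (B j ∩ G j).indicator (fun _ => ENNReal.ofReal (f (s + j))) ω ∂P := by
        rw [lintegral_tsum fun j =>
          (measurable_const.indicator ((hB j).inter (hG j))).aemeasurable]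
        refine tsum_congr fun j => ?_
        rw [lintegral_indicator_const ((hB j).inter (hG j))]
    _ ≤ ∫⁻ ω, m * ENNReal.ofReal
          (f (lastExitTime (fun t => 0 + L t ω) (Metric.ball 0 R)).toReal) ∂P := by
        refine lintegral_mono_ae ?_
        filter_upwards [htrans] with ω hω
        have hfin : lastExitTime (fun t => 0 + L t ω) (Metric.ball 0 R) ≠ ∞ :=
          lastExitTime_ne_top Metric.isBounded_ball (by simpa using hω)
        by_cases hne : ∃ j, ω ∈ B j ∩ G j
        swap
        · push Not at hne
          rw [ENNReal.tsum_eq_zero.2 fun j => indicator_of_notMem (hne j) _]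
          exact zero_le
        classical
        -- Two points of `B(0,R)` are less than `2 * R` apart, so the escape after the first such
        -- visit `j₀` excludes visits from `j₀ + m` on. At most `m` terms survive.
        let j₀ := Nat.find hne
        have hj₀ : ω ∈ B j₀ ∩ G j₀ := Nat.find_spec hne
        have hzero : ∀ j ∉ Finset.Ico j₀ (j₀ + m),
            (B j ∩ G j).indicator (fun _ => ENNReal.ofReal (f (s + j))) ω = 0 := by
          intro j hj
          refine indicator_of_notMem (fun hjm => hj ?_) _
          rw [Finset.mem_Ico]
          refine ⟨Nat.find_min' hne hjm, ?_⟩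
          by_contra! hlt
          have h1 := hj₀.2 (j - j₀) (by omega)
          have e : s + (j₀ : ℝ≥0) + ((j - j₀ : ℕ) : ℝ≥0) = s + j := by
            rw [add_assoc, ← Nat.cast_add]
            congr 2
            omega
          rw [e] at h1
          have h2 : ‖L (s + j) ω‖ < R := by simpa [B] using hjm.1
          have h3 : ‖L (s + j₀) ω‖ < R := by simpa [B] using hj₀.1
          have := norm_sub_le (L (s + j) ω) (L (s + j₀) ω)
          linarith
        rw [tsum_eq_sum hzero]
        refine (Finset.sum_le_card_nsmul _ _ (ENNReal.ofReal
          (f (lastExitTime (fun t => 0 + L t ω) (Metric.ball 0 R)).toReal)) fun j _ => ?_).trans_eq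
          (by simp)
        by_cases hjm : ω ∈ B j ∩ G j
        swap
        · simp [indicator_of_notMem hjm]
        rw [indicator_of_mem hjm]
        refine ENNReal.ofReal_le_ofReal ?_
        have := le_toReal_lastExitTime hfin (t := s + j) (by simpa [B] using hjm.1)
        push_cast at this
        exact hf_mono (by simp; positivity) ENNReal.toReal_nonneg this
    _ = _ := lintegral_const_mul' _ _ (ENNReal.natCast_ne_top m)

end OccupationBound

/-! ### From strong transience to finite integrals -/

section ChungFuchs

variable {Ω : Type*} [MeasurableSpace Ω] {P : Measure Ω} [IsProbabilityMeasure P] {d : ℕ}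
  {L : ℝ≥0 → Ω → EuclideanSpace ℝ (Fin d)} {q : EuclideanSpace ℝ (Fin d) → ℂ}

/-- The integral of `exp (-t q)` over a ball around the origin. -/
noncomputable def semigroupIntegral {d : ℕ} (q : EuclideanSpace ℝ (Fin d) → ℂ) (r t : ℝ) : ℝ≥0∞ :=
  ∫⁻ ξ in Metric.ball (0 : EuclideanSpace ℝ (Fin d)) r,
    ENNReal.ofReal (Real.exp (-(t * (q ξ).re)))

theorem measurable_semigroupIntegral (hq : Measurable fun ξ => (q ξ).re) (r : ℝ) :
    Measurable (semigroupIntegral q r) := by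
  unfold semigroupIntegral
  refine Measurable.lintegral_prod_right'
    (f := fun p : ℝ × EuclideanSpace ℝ (Fin d) => ENNReal.ofReal (Real.exp (-(p.1 * (q p.2).re)))) ?_
  exact (Real.measurable_exp.comp
    (measurable_fst.mul (hq.comp measurable_snd)).neg).ennreal_ofReal

/-- Nothing is known of `f` on the negative axis; freezing it there at `f 0` gives a globally
monotone function. -/
theorem MonotoneOn.measurable_comp_max {f : ℝ → ℝ} (hf : MonotoneOn f (Ici 0)) :
    Measurable fun t => f (max t 0) :=
  Monotone.measurable fun _ _ hab =>
    hf (mem_Ici.2 (le_max_right _ _)) (mem_Ici.2 (le_max_right _ _)) (max_le_max_right 0 hab)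

theorem chungFuchsIntegral_eq (hq : Measurable fun ξ => (q ξ).re) {f : ℝ → ℝ}
    (hf_nonneg : ∀ t, 0 ≤ t → 0 ≤ f t) (hf_mono : MonotoneOn f (Ici 0)) (r : ℝ) :
    chungFuchsIntegral f q r =
      ∫⁻ t in Ioi (0 : ℝ), ENNReal.ofReal (f (max t 0)) * semigroupIntegral q r t := by
  have h1 : chungFuchsIntegral f q r
      = ∫⁻ ξ in Metric.ball (0 : EuclideanSpace ℝ (Fin d)) r, ∫⁻ t in Ioi (0 : ℝ),
        ENNReal.ofReal (f (max t 0)) * ENNReal.ofReal (Real.exp (-(t * (q ξ).re))) := by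
    refine lintegral_congr fun ξ => setLIntegral_congr_fun measurableSet_Ioi fun t ht => ?_
    have ht' : max t 0 = t := max_eq_left (le_of_lt ht)
    rw [ht', ENNReal.ofReal_mul (hf_nonneg t (le_of_lt ht))]
  rw [h1, lintegral_lintegral_swap]
  · refine lintegral_congr fun t => ?_
    rw [lintegral_const_mul' _ _ ENNReal.ofReal_ne_top]
    rfl
  · refine Measurable.aemeasurable ?_
    refine ((hf_mono.measurable_comp_max.comp measurable_snd).ennreal_ofReal).mul ?_
    exact (Real.measurable_exp.comp
      (measurable_snd.mul (hq.comp measurable_fst)).neg).ennreal_ofReal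

theorem lintegral_Ioi_le_lintegral_tsum {F : ℝ → ℝ≥0∞} (hF : Measurable F) :
    ∫⁻ t in Ioi (0 : ℝ), F t ≤ ∫⁻ s in Ioc (0 : ℝ) 1, ∑' j : ℕ, F (s + j) := by
  have hsub : Ioi (0 : ℝ) ⊆ ⋃ j : ℕ, Ioc (j : ℝ) (j + 1) := by
    intro t ht
    have h1 : 0 < ⌈t⌉₊ := Nat.ceil_pos.2 ht
    have h2 : ((⌈t⌉₊ - 1 : ℕ) : ℝ) = ⌈t⌉₊ - 1 := by push_cast [Nat.cast_sub h1]; simp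
    refine mem_iUnion.2 ⟨⌈t⌉₊ - 1, ?_, ?_⟩
    · rw [h2]; linarith [Nat.ceil_lt_add_one (le_of_lt (mem_Ioi.1 ht))]
    · rw [h2]; linarith [Nat.le_ceil t]
  calc ∫⁻ t in Ioi (0 : ℝ), F t ≤ ∫⁻ t in ⋃ j : ℕ, Ioc (j : ℝ) (j + 1), F t :=
        lintegral_mono_set hsub
    _ ≤ ∑' j : ℕ, ∫⁻ t in Ioc (j : ℝ) (j + 1), F t := lintegral_iUnion_le _ _
    _ = ∑' j : ℕ, ∫⁻ s in Ioc (0 : ℝ) 1, F (s + j) := by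
        refine tsum_congr fun j => ?_
        have hmp := measurePreserving_add_right (volume : Measure ℝ) (j : ℝ)
        rw [← hmp.setLIntegral_comp_preimage measurableSet_Ioc hF]
        congr 2
        ext s
        simp
    _ = _ := (lintegral_tsum fun j => (hF.comp (measurable_add_const _)).aemeasurable).symm

/-- `f`-strong transience implies that all Chung–Fuchs integrals are finite. -/
theorem IsStronglyTransient.chungFuchsIntegral_lt_top {f : ℝ → ℝ}
    (hf_nonneg : ∀ t, 0 ≤ t → 0 ≤ f t) (hf_mono : MonotoneOn f (Ici 0))
    (hL : IsLevyProcess L P) (hsymm : IsSymmetricProcess L P) (htrans : IsTransientProcess L P)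
    (hq : IsLevySymbol L P q) (hstrong : IsStronglyTransient f L P) {r : ℝ} (hr : 0 < r) :
    chungFuchsIntegral f q r < ∞ := by
  obtain ⟨R, hR, C, hC⟩ := exists_lintegral_charFun_ball_le (V := EuclideanSpace ℝ (Fin d)) hr
  obtain ⟨m, c, hc, hm⟩ := hL.exists_tsum_le htrans hf_mono R
  set I := ∫⁻ ω, ENNReal.ofReal (f (lastExitTime (fun t => 0 + L t ω) (Metric.ball 0 R)).toReal) ∂P
  have hI : I < ∞ := hstrong 0 _ Metric.isOpen_ball Metric.isBounded_ball
  have hJ : ∀ t : ℝ≥0, semigroupIntegral q r t ≤ C * P.map (L t) (Metric.ball 0 R) := by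
    intro t
    have : IsProbabilityMeasure (P.map (L t)) :=
      Measure.isProbabilityMeasure_map (hL.measurable t).aemeasurable
    exact hC (P.map (L t)) (fun ξ => Real.exp (-(t * (q ξ).re))) (fun ξ => (Real.exp_pos _).le)
      (hq.charFun_eq hL hsymm t)
  rw [chungFuchsIntegral_eq hq.measurable_re hf_nonneg hf_mono]
  have hbound : ∀ s ∈ Ioc (0 : ℝ) 1, ∑' j : ℕ, ENNReal.ofReal (f (max (s + j) 0)) *
      semigroupIntegral q r (s + j) ≤ C * (m * I / c) := by
    intro s hs
    lift s to ℝ≥0 using hs.1.le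
    calc ∑' j : ℕ, ENNReal.ofReal (f (max (s + j) 0)) * semigroupIntegral q r (s + j)
        ≤ ∑' j : ℕ, C * (ENNReal.ofReal (f (s + j)) * P.map (L (s + j)) (Metric.ball 0 R)) := by
          refine ENNReal.tsum_le_tsum fun j => ?_
          rw [max_eq_left (by positivity), mul_left_comm]
          gcongr
          simpa using hJ (s + j)
      _ = C * ∑' j : ℕ, ENNReal.ofReal (f (s + j)) * P.map (L (s + j)) (Metric.ball 0 R) :=
          ENNReal.tsum_mul_left
      _ ≤ C * (m * I / c) := by
          gcongr
          rw [ENNReal.le_div_iff_mul_le (.inl hc)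
            (.inr (ENNReal.mul_ne_top (ENNReal.natCast_ne_top m) hI.ne)), mul_comm]
          exact hm s
  calc _ ≤ _ := lintegral_Ioi_le_lintegral_tsum
        (hf_mono.measurable_comp_max.ennreal_ofReal.mul
          (measurable_semigroupIntegral hq.measurable_re r))
    _ ≤ ∫⁻ _ in Ioc (0 : ℝ) 1, C * (m * I / c) := setLIntegral_mono' measurableSet_Ioc hbound
    _ = C * (m * I / c) := by simp
    _ < ∞ := ENNReal.mul_lt_top ENNReal.coe_lt_top (ENNReal.div_lt_top
        (ENNReal.mul_ne_top (ENNReal.natCast_ne_top m) hI.ne) hc)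

end ChungFuchs

/-! ### Hitting probabilities of short time windows -/

section HittingBound

variable {Ω : Type*} [MeasurableSpace Ω] {P : Measure Ω} {d : ℕ}
  {L : ℝ≥0 → Ω → EuclideanSpace ℝ (Fin d)}

/-- Stochastic continuity at `0` supplies `η`; stationarity makes it uniform in `t`. -/
theorem IsLevyProcess.exists_stay_prob [IsProbabilityMeasure P] (hL : IsLevyProcess L P) {ρ : ℝ} (hρ : 0 < ρ) :
    ∃ η : ℝ≥0, 0 < η ∧ ∀ t s : ℝ≥0, t ≤ s → s ≤ t + η →
      1 / 2 ≤ P {ω | ‖L s ω - L t ω‖ < ρ} := by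
  have h := hL.stochastically_continuous 0 (ENNReal.ofReal ρ) (by simpa using hρ)
  obtain ⟨η, hη, hη'⟩ := Metric.eventually_nhds_iff.1
    (h.eventually (gt_mem_nhds (show (0 : ℝ≥0∞) < 1 / 2 by simp)))
  refine ⟨(η / 2).toNNReal, by simpa using hη, fun t s hts hst => ?_⟩
  have hms : MeasurableSet {x : EuclideanSpace ℝ (Fin d) | ‖x‖ < ρ} :=
    measurableSet_lt (by fun_prop) measurable_const
  have h1 : P {ω | ‖L s ω - L t ω‖ < ρ} = P {ω | ‖L (s - t) ω‖ < ρ} := by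
    have := hL.stationary_increments t (s - t)
    rw [add_tsub_cancel_of_le hts] at this
    have h2 := congrArg (fun μ => μ {x : EuclideanSpace ℝ (Fin d) | ‖x‖ < ρ}) this
    have hsub : Measurable fun ω => L s ω - L t ω := (hL.measurable _).sub (hL.measurable _)
    rwa [Measure.map_apply hsub hms,
      Measure.map_apply (hL.measurable _) hms] at h2
  have h3 : P {ω | ‖L (s - t) ω‖ < ρ}ᶜ ≤ 1 / 2 := by
    refine le_trans (le_of_eq (measure_congr ?_)) (hη' (y := s - t) ?_).le
    · filter_upwards [hL.start_zero] with ω hω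
      refine propext ?_
      change ¬ (‖L (s - t) ω‖ < ρ) ↔ ENNReal.ofReal ρ ≤ edist (L (s - t) ω) (L 0 ω)
      rw [hω, edist_dist, dist_zero_right, ENNReal.ofReal_le_ofReal_iff (norm_nonneg _), not_lt]
    · rw [NNReal.dist_eq, NNReal.coe_zero, sub_zero, abs_of_nonneg (NNReal.coe_nonneg _)]
      have : ((s - t : ℝ≥0) : ℝ) ≤ η / 2 := by
        rw [NNReal.coe_sub hts]
        have h := NNReal.coe_le_coe.2 hst
        rw [NNReal.coe_add, Real.coe_toNNReal _ (by positivity)] at h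
        linarith
      linarith
  rw [h1]
  have hm : MeasurableSet {ω | ‖L (s - t) ω‖ < ρ} := hL.measurable _ hms
  have h4 := prob_add_prob_compl (μ := P) hm
  by_contra! hlt
  have : P {ω | ‖L (s - t) ω‖ < ρ} + P {ω | ‖L (s - t) ω‖ < ρ}ᶜ < 1 / 2 + 1 / 2 :=
    ENNReal.add_lt_add_of_lt_of_le (ne_top_of_le_ne_top (by simp) h3) hlt h3
  rw [h4, ENNReal.add_halves] at this
  exact lt_irrefl _ this

/-- A maximal inequality of Ottaviani type: if the process is in `U` at one of finitely many times,
then it is likely to be near `U` shortly afterwards. -/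
theorem IsLevyProcess.measure_exists_mem_le [IsProbabilityMeasure P] (hL : IsLevyProcess L P)
    {U : Set (EuclideanSpace ℝ (Fin d))} (hU : MeasurableSet U) {ρ : ℝ} {s : ℝ≥0} {t : ℕ → ℝ≥0}
    (ht : Monotone t) (n : ℕ) (hts : ∀ j ≤ n, t j ≤ s)
    (hstay : ∀ j ≤ n, 1 / 2 ≤ P {ω | ‖L s ω - L (t j) ω‖ < ρ}) :
    P {ω | ∃ j ≤ n, L (t j) ω ∈ U} ≤ 2 * P (L s ⁻¹' Metric.thickening ρ U) := by
  -- Decomposition by the first hitting index: the `A j` are disjoint, and each is independent of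
  -- the event `S j` of staying close up to time `s`, which has probability at least `1 / 2`.
  let A : ℕ → Set Ω := fun j => {ω | L (t j) ω ∈ U ∧ ∀ i < j, L (t i) ω ∉ U}
  let S : ℕ → Set Ω := fun j => {ω | ‖L s ω - L (t j) ω‖ < ρ}
  have hA : ∀ j, MeasurableSet (A j) := by
    intro j
    refine (hL.measurable _ hU).inter ?_
    change MeasurableSet {ω | ∀ i < j, L (t i) ω ∉ U}
    simp only [ofPred_forall]
    exact MeasurableSet.iInter fun i => MeasurableSet.iInter fun _ => (hL.measurable _ hU).compl
  have hS : ∀ j, MeasurableSet (S j) := fun j =>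
    measurableSet_lt ((hL.measurable _).sub (hL.measurable _)).norm measurable_const
  have hAS : ∀ j ≤ n, P (A j ∩ S j) = P (A j) * P (S j) := by
    intro j hj
    -- Following `t 0, …, t j` by the constant time `s` makes `L s - L (t j)` the future increment
    -- of index `1`.
    have hτ : Monotone fun i => if i ≤ j then t i else s := by
      intro a b hab
      beta_reduce
      split_ifs with h1 h2 h2
      · exact ht hab
      · exact hts a (h1.trans hj)
      · omega
      · rfl
    have hind := hL.indepFun_past_future hτ j
    have h1 : MeasurableSet {x : ℕ → EuclideanSpace ℝ (Fin d) | x j ∈ U ∧ ∀ i < j, x i ∉ U} := by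
      refine (measurable_pi_apply j hU).inter ?_
      change MeasurableSet {x : ℕ → EuclideanSpace ℝ (Fin d) | ∀ i < j, x i ∉ U}
      simp only [ofPred_forall]
      exact MeasurableSet.iInter fun i => MeasurableSet.iInter fun _ =>
        (measurable_pi_apply i hU).compl
    have h2 : MeasurableSet {x : ℕ → EuclideanSpace ℝ (Fin d) | ‖x 1‖ < ρ} :=
      measurableSet_lt (by fun_prop) measurable_const
    have := hind.measure_inter_preimage_eq_mul _ _ h1 h2
    convert! this using 3
    · ext ω
      simp only [A, mem_ofPred_eq, mem_preimage, min_self, if_true, min_le_right]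
      refine and_congr_right fun _ => forall₂_congr fun i hi => ?_
      rw [min_eq_left hi.le]
    · ext ω
      simp [S]
    · ext ω
      simp only [A, mem_ofPred_eq, mem_preimage, min_self, if_true, min_le_right]
      refine and_congr_right fun _ => forall₂_congr fun i hi => ?_
      rw [min_eq_left hi.le]
    · ext ω
      simp [S]
  have hdisj : Set.PairwiseDisjoint (Finset.range (n + 1) : Set ℕ) fun j => A j ∩ S j := by
    intro i _ j _ hij
    rw [Function.onFun, Set.disjoint_left]
    rintro ω ⟨hi, -⟩ ⟨hj, -⟩
    rcases lt_or_gt_of_ne hij with h | h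
    · exact hj.2 i h hi.1
    · exact hi.2 j h hj.1
  classical
  calc P {ω | ∃ j ≤ n, L (t j) ω ∈ U} ≤ P (⋃ j ∈ Finset.range (n + 1), A j) := by
        refine measure_mono fun ω hω => ?_
        obtain ⟨j, hj, hjU⟩ := hω
        have hex : ∃ j, L (t j) ω ∈ U := ⟨j, hjU⟩
        refine mem_biUnion (x := Nat.find hex) ?_
          ⟨Nat.find_spec hex, fun i hi => Nat.find_min hex hi⟩
        simpa using Nat.lt_succ_of_le ((Nat.find_min' hex hjU).trans hj)
    _ ≤ ∑ j ∈ Finset.range (n + 1), P (A j) := measure_biUnion_finset_le _ _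
    _ ≤ ∑ j ∈ Finset.range (n + 1), 2 * P (A j ∩ S j) := by
        refine Finset.sum_le_sum fun j hj => ?_
        have hj' : j ≤ n := by simpa [Nat.lt_succ_iff] using hj
        rw [hAS j hj', mul_left_comm]
        refine le_mul_of_one_le_right zero_le ?_
        calc (1 : ℝ≥0∞) = 2 * (1 / 2) := by
              rw [one_div, ENNReal.mul_inv_cancel (by simp) (by simp)]
          _ ≤ _ := by gcongr; exact hstay j hj'
    _ = 2 * P (⋃ j ∈ Finset.range (n + 1), A j ∩ S j) := by
        rw [← Finset.mul_sum, measure_biUnion_finset hdisj fun j _ => (hA j).inter (hS j)]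
    _ ≤ _ := by
        gcongr
        intro ω hω
        simp only [mem_iUnion] at hω
        obtain ⟨j, _, hj, hj'⟩ := hω
        rw [mem_preimage, Metric.mem_thickening_iff]
        exact ⟨_, hj.1, by rw [dist_eq_norm]; exact hj'⟩

/-- The event that all sufficiently fine regular grids on `[a, a + w]` contain a time at which the
path is in `U`. -/
def gridHitEvent {Ω : Type*} {d : ℕ} (L : ℝ≥0 → Ω → EuclideanSpace ℝ (Fin d)) (U : Set (EuclideanSpace ℝ (Fin d)))
    (a w : ℝ≥0) : Set Ω :=
  ⋃ N : ℕ, ⋂ n ≥ N, {ω | ∃ j ≤ n + 1, L (a + j * (w / (n + 1 : ℕ))) ω ∈ U}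

theorem IsLevyProcess.measurableSet_gridHitEvent (hL : IsLevyProcess L P)
    {U : Set (EuclideanSpace ℝ (Fin d))} (hU : MeasurableSet U) (a w : ℝ≥0) :
    MeasurableSet (gridHitEvent L U a w) := by
  refine MeasurableSet.iUnion fun N => MeasurableSet.iInter fun n => MeasurableSet.iInter fun _ => ?_
  have : {ω | ∃ j ≤ n + 1, L (a + j * (w / (n + 1 : ℕ))) ω ∈ U}
      = ⋃ j ≤ n + 1, L (a + j * (w / (n + 1 : ℕ))) ⁻¹' U := by
    ext ω; simp
  rw [this]
  exact MeasurableSet.iUnion fun j => MeasurableSet.iUnion fun _ => hL.measurable _ hU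

/-- The union over `N` is increasing, and its `N`-th set is contained in the hitting event of a
single grid, where the maximal inequality applies with a bound free of `N`. -/
theorem IsLevyProcess.measure_gridHitEvent_le [IsProbabilityMeasure P] (hL : IsLevyProcess L P)
    {U : Set (EuclideanSpace ℝ (Fin d))} (hU : MeasurableSet U) {ρ : ℝ} {η : ℝ≥0}
    (hη : ∀ t s : ℝ≥0, t ≤ s → s ≤ t + η → 1 / 2 ≤ P {ω | ‖L s ω - L t ω‖ < ρ})
    {a w s : ℝ≥0} (has : a + w ≤ s) (hsa : s ≤ a + η) :
    P (gridHitEvent L U a w) ≤ 2 * P (L s ⁻¹' Metric.thickening ρ U) := by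
  unfold gridHitEvent
  rw [Monotone.measure_iUnion]
  · refine iSup_le fun N => ?_
    refine (measure_mono (iInter₂_subset N le_rfl)).trans ?_
    have hle : ∀ j ≤ N + 1, a + (j : ℝ≥0) * (w / (N + 1 : ℕ)) ≤ s := by
      intro j hj
      refine le_trans ?_ has
      gcongr
      calc (j : ℝ≥0) * (w / (N + 1 : ℕ)) ≤ (N + 1 : ℕ) * (w / (N + 1 : ℕ)) := by gcongr
        _ = w := mul_div_cancel₀ _ (by positivity)
    refine hL.measure_exists_mem_le hU (t := fun j => a + (j : ℝ≥0) * (w / (N + 1 : ℕ)))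
      (fun i j hij => ?_) (N + 1) hle fun j hj => hη _ _ (hle j hj) ?_
    · beta_reduce
      gcongr
    · refine hsa.trans ?_
      gcongr
      exact le_self_add
  · intro N M hNM
    exact biInter_mono (fun n hn => le_trans hNM hn) fun _ _ => le_rfl

theorem mem_gridHitEvent {Ω : Type*} {d : ℕ} {L : ℝ≥0 → Ω → EuclideanSpace ℝ (Fin d)}
    {U : Set (EuclideanSpace ℝ (Fin d))} (hU : IsOpen U) {a w u : ℝ≥0} {ω : Ω}
    (hcont : ContinuousWithinAt (fun s => L s ω) (Ici u) u) (hau : a ≤ u) (huw : u < a + w)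
    (hu : L u ω ∈ U) : ω ∈ gridHitEvent L U a w := by
  obtain ⟨ε, hε, hεU⟩ := Metric.mem_nhdsWithin_iff.1 (hcont.preimage_mem_nhdsWithin
    (hU.mem_nhds hu))
  have hw : (0 : ℝ) < w := by
    have h1 : (a : ℝ) ≤ u := hau
    have h2 : (u : ℝ) < a + w := huw
    linarith
  obtain ⟨N, hN⟩ := exists_nat_gt (w / ε : ℝ)
  refine mem_iUnion.2 ⟨N, mem_iInter₂.2 fun n hn => ?_⟩
  have hn0 : (0 : ℝ) < (n + 1 : ℕ) := by positivity
  set δ : ℝ≥0 := w / (n + 1 : ℕ) with hδ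
  have hδc : (δ : ℝ) = w / (n + 1 : ℕ) := by rw [hδ]; push_cast; rfl
  have hδ0 : (0 : ℝ) < δ := by rw [hδc]; positivity
  have hδε : (δ : ℝ) < ε := by
    rw [hδc, div_lt_iff₀ hn0]
    rw [div_lt_iff₀ hε] at hN
    have : (N : ℝ) ≤ (n + 1 : ℕ) := by exact_mod_cast Nat.le_succ_of_le hn
    nlinarith
  have hau' : (0 : ℝ) ≤ u - a := sub_nonneg.2 hau
  have hc1 := Nat.le_ceil ((u - a : ℝ) / δ)
  have hc2 := Nat.ceil_lt_add_one (div_nonneg hau' hδ0.le)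
  rw [div_le_iff₀ hδ0] at hc1
  have hc3 : (⌈(u - a : ℝ) / δ⌉₊ : ℝ) * δ < (u - a) + δ := by
    have := mul_lt_mul_of_pos_right hc2 hδ0
    rwa [add_mul, one_mul, div_mul_cancel₀ _ hδ0.ne'] at this
  -- The first grid point at or after `u`. It lies within one mesh, hence less than `ε`, to the
  -- right of `u`, where right-continuity keeps the path in `U`.
  refine ⟨⌈(u - a : ℝ) / δ⌉₊, ?_, ?_⟩
  · refine Nat.ceil_le.2 ?_
    rw [div_le_iff₀ hδ0, hδc, mul_div_cancel₀ _ hn0.ne']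
    have : (u : ℝ) < a + w := huw
    linarith
  · refine hεU ⟨?_, ?_⟩
    · rw [Metric.mem_ball, NNReal.dist_eq, abs_lt]
      push_cast
      constructor <;> linarith
    · rw [mem_Ici, ← NNReal.coe_le_coe]
      push_cast
      linarith

end HittingBound

/-! ### From a finite integral to strong transience -/

section StrongTransience

variable {Ω : Type*} [MeasurableSpace Ω] {P : Measure Ω} [IsProbabilityMeasure P] {d : ℕ}
  {L : ℝ≥0 → Ω → EuclideanSpace ℝ (Fin d)} {q : EuclideanSpace ℝ (Fin d) → ℂ}

/-- Pathwise bound for the last exit time by the hitting events of consecutive time windows. -/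
theorem ofReal_lastExitTime_le {Ω : Type*} {d : ℕ} {L : ℝ≥0 → Ω → EuclideanSpace ℝ (Fin d)}
    {f : ℝ → ℝ} (hf_mono : MonotoneOn f (Ici 0)) {U : Set (EuclideanSpace ℝ (Fin d))}
    (hU : IsOpen U) {h : ℝ≥0} (hh : 0 < h) {ω : Ω}
    (hcont : ∀ t : ℝ≥0, ContinuousWithinAt (fun s => L s ω) (Ici t) t)
    (hfin : lastExitTime (fun t => L t ω) U ≠ ∞) :
    ENNReal.ofReal (f (lastExitTime (fun t => L t ω) U).toReal) ≤ ENNReal.ofReal (f 0) +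
      ∑' k : ℕ, (gridHitEvent L U (k * h) (2 * h)).indicator
        (fun _ => ENNReal.ofReal (f ((k + 1) * h))) ω := by
  lift lastExitTime (fun t => L t ω) U to ℝ≥0 using hfin with ℓ hℓ
  rcases eq_zero_or_pos ℓ with h0 | hpos
  · simp [h0]
  have hh' : (0 : ℝ) < h := hh
  have hd : 0 < (ℓ / h : ℝ) := div_pos hpos hh
  -- Here `k * h < ℓ ≤ (k + 1) * h`. The supremum `ℓ` need not be attained, but some visit `u` lies
  -- in `(k * h, ℓ]`. The window has length `2 * h` so that `u` is strictly before its end.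
  obtain ⟨k, hk⟩ : ∃ k, ⌈(ℓ / h : ℝ)⌉₊ = k + 1 := Nat.exists_eq_succ_of_ne_zero
    (Nat.ceil_pos.2 hd).ne'
  have hk1 : (ℓ : ℝ) ≤ (k + 1) * h := by
    have := Nat.le_ceil (ℓ / h : ℝ)
    rw [hk, div_le_iff₀ hh'] at this
    exact_mod_cast this
  have hk2 : (k : ℝ) * h < ℓ := by
    have := Nat.ceil_lt_add_one hd.le
    rw [hk] at this
    push_cast at this
    rw [← lt_div_iff₀ hh']
    linarith
  have hlt : (((k : ℝ≥0) * h : ℝ≥0) : ℝ≥0∞) < lastExitTime (fun t => L t ω) U := by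
    rw [← hℓ]
    exact_mod_cast hk2
  simp only [lastExitTime, lt_iSup_iff] at hlt
  obtain ⟨u, hu, hku⟩ := hlt
  have huℓ : (u : ℝ) ≤ ℓ := by
    have : (u : ℝ≥0∞) ≤ ℓ := by
      rw [hℓ]
      exact le_iSup₂ (f := fun (t : ℝ≥0) (_ : t ∈ {t : ℝ≥0 | L t ω ∈ U}) => (t : ℝ≥0∞)) u hu
    exact_mod_cast this
  have hmem : ω ∈ gridHitEvent L U (k * h) (2 * h) := by
    refine mem_gridHitEvent hU (hcont u) (ENNReal.coe_lt_coe.1 hku).le ?_ hu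
    rw [← NNReal.coe_lt_coe]
    push_cast
    linarith
  calc ENNReal.ofReal (f (ℓ : ℝ≥0∞).toReal) ≤ ENNReal.ofReal (f ((k + 1) * h)) :=
        ENNReal.ofReal_le_ofReal (hf_mono (mem_Ici.2 ENNReal.toReal_nonneg)
          (mem_Ici.2 (by positivity)) (by simpa using hk1))
    _ = (gridHitEvent L U (k * h) (2 * h)).indicator
          (fun _ => ENNReal.ofReal (f ((k + 1) * h))) ω := by rw [indicator_of_mem hmem]
    _ ≤ _ := (ENNReal.le_tsum k).trans le_add_self

theorem tsum_lintegral_Ioc_le (F : ℝ → ℝ≥0∞) {h : ℝ} (hh : 0 < h) :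
    ∑' k : ℕ, ∫⁻ s in Ioc ((k + 2) * h) ((k + 3) * h), F s ≤ ∫⁻ s in Ioi (0 : ℝ), F s := by
  have hmono : Monotone fun k : ℕ => ((k : ℝ) + 2) * h := fun a b hab => by
    have : (a : ℝ) ≤ b := Nat.cast_le.2 hab
    beta_reduce
    gcongr
  have hdisj := hmono.pairwise_disjoint_on_Ioc_succ
  have heq : ∀ k : ℕ, Ioc (((k : ℝ) + 2) * h) ((k + 3) * h)
      = Ioc (((k : ℝ) + 2) * h) (((Order.succ k : ℕ) + 2) * h) := by
    intro k
    rw [Nat.succ_eq_succ]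
    push_cast
    ring_nf
  simp only [heq]
  rw [← lintegral_iUnion (fun k => measurableSet_Ioc) hdisj]
  refine lintegral_mono_set (iUnion_subset fun k s hs => ?_)
  exact lt_trans (by positivity) hs.1

/-- Finiteness of one Chung–Fuchs integral implies `f`-strong transience. -/
theorem isStronglyTransient_of_chungFuchsIntegral_lt_top {f : ℝ → ℝ}
    (hf_nonneg : ∀ t, 0 ≤ t → 0 ≤ f t) (hf_mono : MonotoneOn f (Ici 0))
    (hL : IsLevyProcess L P) (hsymm : IsSymmetricProcess L P) (htrans : IsTransientProcess L P)
    (hq : IsLevySymbol L P q) {r : ℝ} (hr : 0 < r) (hfin : chungFuchsIntegral f q r < ∞) :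
    IsStronglyTransient f L P := by
  intro x O hO hOb
  set U : Set (EuclideanSpace ℝ (Fin d)) := (fun y => x + y) ⁻¹' O with hUdef
  have hU : IsOpen U := hO.preimage (by fun_prop)
  have hUb : Bornology.IsBounded U := by
    obtain ⟨R, hR⟩ := hOb.exists_norm_le
    refine isBounded_iff_forall_norm_le.2 ⟨R + ‖x‖, fun y hy => ?_⟩
    have h1 := hR _ hy
    have h2 := norm_sub_le (x + y) x
    rw [add_sub_cancel_left] at h2
    linarith
  change ∫⁻ ω, ENNReal.ofReal (f (lastExitTime (fun t => L t ω) U).toReal) ∂P < ∞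
  obtain ⟨δ, hδ, C, hC⟩ :=
    exists_measure_ball_le_lintegral_charFun (V := EuclideanSpace ℝ (Fin d)) hr
  obtain ⟨η, hη, hstay⟩ := hL.exists_stay_prob (ρ := 1) one_pos
  -- The neighbourhood of `U` is covered by finitely many `δ`-balls, each with mass at most `C *
  -- semigroupIntegral q r t` whatever its centre.
  obtain ⟨T, hTfin, hT⟩ := Metric.totallyBounded_iff.1
    (hUb.thickening (δ := 1)).isCompact_closure.totallyBounded δ hδ
  lift T to Finset (EuclideanSpace ℝ (Fin d)) using hTfin
  have hJ : ∀ t : ℝ≥0, P (L t ⁻¹' Metric.thickening 1 U)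
      ≤ T.card * (C * semigroupIntegral q r t) := by
    intro t
    have : IsProbabilityMeasure (P.map (L t)) :=
      Measure.isProbabilityMeasure_map (hL.measurable t).aemeasurable
    rw [← Measure.map_apply (hL.measurable t) Metric.isOpen_thickening.measurableSet]
    calc P.map (L t) (Metric.thickening 1 U)
        ≤ P.map (L t) (⋃ y ∈ T, Metric.ball y δ) := measure_mono (subset_closure.trans (by simpa using hT))
      _ ≤ ∑ y ∈ T, P.map (L t) (Metric.ball y δ) := measure_biUnion_finset_le _ _
      _ ≤ ∑ _y ∈ T, C * semigroupIntegral q r t := Finset.sum_le_sum fun y _ =>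
          hC (P.map (L t)) (fun ξ => Real.exp (-(t * (q ξ).re))) (fun ξ => (Real.exp_pos _).le)
            (hq.charFun_eq hL hsymm t) y
      _ = _ := by simp
  -- The window `[k h, (k + 2) h]` and the averaging interval `((k + 2) h, (k + 3) h]` then fit
  -- together into a stretch of length `η`.
  set h : ℝ≥0 := η / 3 with hhdef
  have hh : 0 < h := by positivity
  have hh3 : 3 * h = η := mul_div_cancel₀ _ (by norm_num)
  let D : ℕ → Set Ω := fun k => gridHitEvent L U (k * h) (2 * h)
  have hD : ∀ k, MeasurableSet (D k) := fun k => hL.measurableSet_gridHitEvent hU.measurableSet _ _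
  have hterm : ∀ k : ℕ, h * (ENNReal.ofReal (f ((k + 1) * h)) * P (D k)) ≤
      ∫⁻ s in Ioc (((k : ℝ) + 2) * h) ((k + 3) * h), (2 * T.card * C : ℝ≥0) *
        (ENNReal.ofReal (f (max s 0)) * semigroupIntegral q r s) := by
    intro k
    calc (h : ℝ≥0∞) * (ENNReal.ofReal (f ((k + 1) * h)) * P (D k))
        = ∫⁻ _ in Ioc (((k : ℝ) + 2) * h) ((k + 3) * h),
            ENNReal.ofReal (f ((k + 1) * h)) * P (D k) := by
          rw [setLIntegral_const, Real.volume_Ioc, mul_comm]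
          congr 1
          rw [← sub_mul]
          norm_num
      _ ≤ _ := by
          refine setLIntegral_mono' measurableSet_Ioc fun s hs => ?_
          have hs0 : 0 ≤ s := le_trans (by positivity) hs.1.le
          lift s to ℝ≥0 using hs0
          have h1 : P (D k) ≤ 2 * (T.card * (C * semigroupIntegral q r s)) := by
            refine (hL.measure_gridHitEvent_le hU.measurableSet hstay (s := s) ?_ ?_).trans
              (mul_le_mul_right (hJ s) _)
            · rw [← NNReal.coe_le_coe]
              push_cast
              linarith [hs.1]
            · rw [← NNReal.coe_le_coe, ← hh3]
              push_cast
              linarith [hs.2]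
          have h2 : f ((k + 1) * h) ≤ f (max s 0) := by
            rw [max_eq_left s.coe_nonneg]
            refine hf_mono (mem_Ici.2 (by positivity)) (mem_Ici.2 s.coe_nonneg) ?_
            have : (0 : ℝ) ≤ h := h.coe_nonneg
            linarith [hs.1]
          calc ENNReal.ofReal (f ((k + 1) * h)) * P (D k)
              ≤ ENNReal.ofReal (f (max s 0)) * (2 * (T.card * (C * semigroupIntegral q r s))) := by
                gcongr
            _ = _ := by push_cast; ring
  have hsum : h * ∑' k : ℕ, ENNReal.ofReal (f ((k + 1) * h)) * P (D k) < ∞ := by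
    rw [← ENNReal.tsum_mul_left]
    calc _ ≤ _ := ENNReal.tsum_le_tsum hterm
      _ ≤ _ := tsum_lintegral_Ioc_le _ hh
      _ = (2 * T.card * C : ℝ≥0) * chungFuchsIntegral f q r := by
          rw [lintegral_const_mul' _ _ ENNReal.coe_ne_top,
            ← chungFuchsIntegral_eq hq.measurable_re hf_nonneg hf_mono]
      _ < ∞ := ENNReal.mul_lt_top ENNReal.coe_lt_top hfin
  have hsum' : ∑' k : ℕ, ENNReal.ofReal (f ((k + 1) * h)) * P (D k) < ∞ :=
    ENNReal.lt_top_of_mul_ne_top_right hsum.ne (by simpa using hh.ne')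
  calc ∫⁻ ω, ENNReal.ofReal (f (lastExitTime (fun t => L t ω) U).toReal) ∂P
      ≤ ∫⁻ ω, (ENNReal.ofReal (f 0) +
          ∑' k : ℕ, (D k).indicator (fun _ => ENNReal.ofReal (f ((k + 1) * h))) ω) ∂P := by
        refine lintegral_mono_ae ?_
        filter_upwards [htrans, hL.cadlag] with ω h1 h2
        exact ofReal_lastExitTime_le hf_mono hU hh (fun t => (h2 t).1) (lastExitTime_ne_top hUb h1)
    _ = ENNReal.ofReal (f 0) + ∑' k : ℕ, ENNReal.ofReal (f ((k + 1) * h)) * P (D k) := by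
        rw [lintegral_add_left measurable_const, lintegral_const, measure_univ, mul_one,
          lintegral_tsum fun k => (measurable_const.indicator (hD k)).aemeasurable]
        simp only [lintegral_indicator_const (hD _)]
    _ < ∞ := ENNReal.add_lt_top.2 ⟨ENNReal.ofReal_lt_top, hsum'⟩

end StrongTransience

/-! ### The equivalence -/

theorem corollaryc3p9 {Ω : Type*} [MeasurableSpace Ω] (P : Measure Ω) [IsProbabilityMeasure P]
    (d : ℕ) (L : ℝ≥0 → Ω → EuclideanSpace ℝ (Fin d)) (q : EuclideanSpace ℝ (Fin d) → ℂ)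
    (f : ℝ → ℝ)
    (hf_nonneg : ∀ t, 0 ≤ t → 0 ≤ f t)
    (hf_mono : MonotoneOn f (Ici 0))
    (hf_C1 : ContDiffOn ℝ 1 f (Ici 0))
    (hL : IsLevyProcess L P)
    (hsymm : IsSymmetricProcess L P)
    (htrans : IsTransientProcess L P)
    (hq : IsLevySymbol L P q) :
    (IsWeaklyTransient f L P ↔ ∃ r : ℝ, 0 < r ∧ chungFuchsIntegral f q r = ∞) ∧
      (IsWeaklyTransient f L P ↔ ∀ r : ℝ, 0 < r → chungFuchsIntegral f q r = ∞) := by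
  have hall : IsWeaklyTransient f L P → ∀ r : ℝ, 0 < r → chungFuchsIntegral f q r = ∞ := by
    intro hw r hr
    by_contra hne
    exact hw (isStronglyTransient_of_chungFuchsIntegral_lt_top hf_nonneg hf_mono hL hsymm htrans hq
      hr (lt_top_iff_ne_top.2 hne))
  have hex : (∃ r : ℝ, 0 < r ∧ chungFuchsIntegral f q r = ∞) → IsWeaklyTransient f L P := by
    rintro ⟨r, hr, hI⟩ hstrong
    exact (hstrong.chungFuchsIntegral_lt_top hf_nonneg hf_mono hL hsymm htrans hq hr).ne hI
  exact ⟨⟨fun hw => ⟨1, one_pos, hall hw 1 one_pos⟩, hex⟩,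
    ⟨hall, fun h => hex ⟨1, one_pos, h 1 one_pos⟩⟩⟩
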